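/- Setting. Let $W=(Y,D,X,Z)$ have distribution $F_0$, where $Y$ is a real integrable outcome, $D\in\{0,1\}$ a treatment, $X\in\mathcal X$ covariates and $Z\in\mathcal Z$ instruments (possibly trivial). For a distribution $F$ of $W$ let $\gamma(F)=(\eta(1,\cdot),\eta(0,\cdot),p(\cdot))$ be its nuisance parameter, $\eta(d,x,z)=E_F[Y\mid D=d,X=x,Z=z]$ and $p(x,z)=P_F(D=1\mid X=x,Z=z)$; put $\gamma_0=\gamma(F_0)$, and let $\|\cdot\|$ be a (semi)norm on a linear space of nuisance functions that contains $\gamma_0$ and all the estimates below. Let $\delta,\delta^*:\mathcal X\to\{0,1\}$ be treatment rules, $\theta_{10}(x)=1\{\delta(x)=1,\delta^*(x)=0\}$, $\theta_{01}(x)=1\{\delta(x)=0,\delta^*(x)=1\}$, and let $\underline\Delta(\gamma)(x)$, $\bar\Delta(\gamma)(x)$ be the lower and upper bound on the conditional average treatment effect, as functions of $\gamma$. Let $\beta_*$ stand for the lower bound $\beta_l$ or the upper bound $\beta_u$ on the welfare gain from switching from $\delta^*$ to $\delta$, with $$m(w,\beta_l,\gamma)=\underline\Delta(\gamma)(x)\theta_{10}(x)-\bar\Delta(\gamma)(x)\theta_{01}(x)-\beta_l,\qquad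 m(w,\beta_u,\gamma)=\bar\Delta(\gamma)(x)\theta_{10}(x)-\underline\Delta(\gamma)(x)\theta_{01}(x)-\beta_u .$$ The true value $\beta_{*,0}$ satisfies $E[m(W,\beta_{*,0},\gamma_0)]=0$. Let $\psi(w,\beta_*,\gamma)=m(w,\beta_*,\gamma)+\phi(w,\gamma)$ be the orthogonalized moment function, where $\phi(\cdot,\gamma_0)$ is the influence function of $F\mapsto E_{F_0}[m(W,\beta_{*,0},\gamma(F))]$ at $F_0$: it is $F_0$-integrable and, with $F_\tau=(1-\tau)F_0+\tau G$, one has $\frac{d}{d\tau}E_{F_0}[m(W,\beta_{*,0},\gamma(F_\tau))]\big|_{\tau=0}=\int\phi(w,\gamma_0)\,G(dw)$ for every distribution $G$ with a bounded density with respect to $F_0$ (the expectations being finite for small $\tau\ge 0$). Let $K>1$ be fixed, let $\{1,\dots,n\}$ be partitioned into groups $\mathcal I_1,\dots,\mathcal I_K$ for every $n$, let $\hat\gamma_k$ be a first-step estimate computed from the observations $w_i$ with $i\notin\mathcal I_k$, and let $\hat\beta_*$ solve $\frac1n\sum_{k=1}^K\sum_{i\in\mathcal I_k}\psi(w_i,\hat\beta_*,\hat\gamma_k)=0$.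 Theorem. Suppose that $w_1,w_2,\dots$ are i.i.d. with distribution $F_0$, that for each $k=1,\dots,K$ (i) $\int|\psi(w,\beta_{*,0},\hat\gamma_k)-\psi(w,\beta_{*,0},\gamma_0)|^2F_0(dw)\to 0$ in probability, (ii) $\left|\int\psi(w,\beta_{*,0},\hat\gamma_k)F_0(dw)\right|\le C\|\hat\gamma_k-\gamma_0\|^2$ almost surely for all large $n$, with a constant $C>0$, (iii) $\|\hat\gamma_k-\gamma_0\|=o_p(n^{-1/4})$, that $\hat\beta_*\to\beta_{*,0}$ in probability, and that $\Omega_*=E[\psi(W,\beta_{*,0},\gamma_0)^2]<\infty$. Then $$\sqrt n\,(\hat\beta_*-\beta_{*,0})\ \overset{d}{\longrightarrow}\ \mathcal N(0,\Omega_*).$$ If moreover (iv) there are $\zeta>0$ and a function $d$ with $E[d(W)^2]<\infty$ such that, for $F_0$-almost every $w$, $|\psi(w,\beta_*,\gamma)-\psi(w,\beta_{*,0},\gamma_0)|\le d(w)\big(|\beta_*-\beta_{*,0}|^\zeta+\|\gamma-\gamma_0\|^\zeta\big)$ for all $\beta_*$ and $\gamma$ with $|\beta_*-\beta_{*,0}|$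 and $\|\gamma-\gamma_0\|$ small enough, then $$\hat\Omega_*=\frac1n\sum_{k=1}^K\sum_{i\in\mathcal I_k}\psi(w_i,\hat\beta_*,\hat\gamma_k)^2\ \overset{p}{\longrightarrow}\ \Omega_* .$$ -/

import Mathlib

open MeasureTheory ProbabilityTheory Filter Topology
open scoped ENNReal NNReal

noncomputable section

/-- An observation `W = (Y, D, X, Z)`: outcome, binary treatment (`true` is `1`), covariates and
instruments.  Without instruments, take `𝒵` to be a one-point space. -/
abbrev Obs (𝒳 𝒵 : Type*) := ℝ × Bool × 𝒳 × 𝒵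

namespace Obs

variable {𝒳 𝒵 : Type*}

/-- The outcome `y`. -/
def outcome (w : Obs 𝒳 𝒵) : ℝ := w.1

/-- The treatment `d`. -/
def treat (w : Obs 𝒳 𝒵) : Bool := w.2.1

/-- The covariates `x`. -/
def cov (w : Obs 𝒳 𝒵) : 𝒳 := w.2.2.1

/-- The conditioning variables `(x, z)`. -/
def cond (w : Obs 𝒳 𝒵) : 𝒳 × 𝒵 := w.2.2

end Obs

/-- Values of the nuisance parameter `γ = (η(1, ·), η(0, ·), p(·))`: triples of functions of the
conditioning variables. -/
abbrev Nuisance (V : Type*) := (V → ℝ) × (V → ℝ) × (V → ℝ)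

namespace Nuisance

variable {V : Type*}

/-- The conditional mean treatment response `η(d, ·)`. -/
def eta (γ : Nuisance V) (d : Bool) : V → ℝ := if d then γ.1 else γ.2.1

/-- The propensity score `p(·)`. -/
def prop (γ : Nuisance V) : V → ℝ := γ.2.2

end Nuisance

/-- `γ` is (a version of) the nuisance parameter of the distribution `F` of `W`:
`η(D, X, Z) = E_F[Y | D, X, Z]` and `p(X, Z) = P_F(D = 1 | X, Z)`, almost surely. -/
structure IsNuisanceOf {𝒳 𝒵 : Type*} [MeasurableSpace 𝒳] [MeasurableSpace 𝒵]
    (F : Measure (Obs 𝒳 𝒵)) (γ : Nuisance (𝒳 × 𝒵)) : Prop where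
  measurable_eta : ∀ d, Measurable (γ.eta d)
  measurable_prop : Measurable γ.prop
  condExp_outcome :
    F[Obs.outcome | MeasurableSpace.comap (fun w => (w.treat, w.cond)) inferInstance]
      =ᵐ[F] fun w => γ.eta w.treat w.cond
  condExp_treat :
    F[fun w => if w.treat then (1 : ℝ) else 0 | MeasurableSpace.comap Obs.cond inferInstance]
      =ᵐ[F] fun w => γ.prop w.cond

/-- Which of the two bounds on the welfare gain is considered. -/
inductive BoundSide
  | lower
  | upper

section Moments

variable {𝒳 𝒵 : Type*}

/-- `θ₁₀(x) = 1{δ(x) = 1, δ*(x) = 0}`: the newly treated. -/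
def theta10 (δ δs : 𝒳 → Bool) (x : 𝒳) : ℝ := if δ x = true ∧ δs x = false then 1 else 0

/-- `θ₀₁(x) = 1{δ(x) = 0, δ*(x) = 1}`: those no longer treated. -/
def theta01 (δ δs : 𝒳 → Bool) (x : 𝒳) : ℝ := if δ x = false ∧ δs x = true then 1 else 0

/-- The original moment function `m(w, β, γ)` of the lower or of the upper bound on the welfare
gain from switching from `δs` to `δ`, where `ΔL γ` and `ΔU γ` are the lower and the upper bound on
the conditional average treatment effect, as functions of the nuisance parameter `γ`. -/
def boundMoment (side : BoundSide) (δ δs : 𝒳 → Bool) (ΔL ΔU : Nuisance (𝒳 × 𝒵) → 𝒳 → ℝ)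
    (w : Obs 𝒳 𝒵) (β : ℝ) (γ : Nuisance (𝒳 × 𝒵)) : ℝ :=
  match side with
  | .lower => ΔL γ w.cov * theta10 δ δs w.cov - ΔU γ w.cov * theta01 δ δs w.cov - β
  | .upper => ΔU γ w.cov * theta10 δ δs w.cov - ΔL γ w.cov * theta01 δ δs w.cov - β

/-- The orthogonalized moment function `ψ = m + φ`.  The adjustment term does not involve `β`,
because `β` enters `m` only through the summand `-β`, which does not depend on the nuisance
parameter. -/
def orthMoment (side : BoundSide) (δ δs : 𝒳 → Bool) (ΔL ΔU : Nuisance (𝒳 × 𝒵) → 𝒳 → ℝ)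
    (φ : Obs 𝒳 𝒵 → Nuisance (𝒳 × 𝒵) → ℝ)
    (w : Obs 𝒳 𝒵) (β : ℝ) (γ : Nuisance (𝒳 × 𝒵)) : ℝ :=
  boundMoment side δ δs ΔL ΔU w β γ + φ w γ

end Moments

/-- The path of distributions `F_τ = (1 - τ) F₀ + τ G`. -/
def mixPath {W : Type*} [MeasurableSpace W] (F₀ G : Measure W) (τ : ℝ) : Measure W :=
  ENNReal.ofReal (1 - τ) • F₀ + ENNReal.ofReal τ • G

/-- `φ₀` is the influence function at `F₀` of `F ↦ ∫ μ(w, γ(F)) F₀(dw)`, i.e. of the effect that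
the first step has on the moment `μ`: along `F_τ = (1 - τ) F₀ + τ G` the derivative at `τ = 0` is
`∫ φ₀ dG`, for all alternative distributions `G` with a bounded density with respect to `F₀`.
(The choice `G = F₀` shows that `∫ φ₀ dF₀ = 0`.) -/
def IsFirstStepInfluence {W Γ : Type*} [MeasurableSpace W] (F₀ : Measure W)
    (γF : Measure W → Γ) (μ : W → Γ → ℝ) (φ₀ : W → ℝ) : Prop :=
  Integrable φ₀ F₀ ∧
  ∀ G : Measure W, IsProbabilityMeasure G → (∃ c : ℝ≥0, G ≤ c • F₀) →
    (∀ᶠ τ in 𝓝[Set.Icc 0 1] (0 : ℝ), Integrable (fun w => μ w (γF (mixPath F₀ G τ))) F₀) ∧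
    HasDerivWithinAt (fun τ : ℝ => ∫ w, μ w (γF (mixPath F₀ G τ)) ∂F₀) (∫ w, φ₀ w ∂G)
      (Set.Icc 0 1) 0

section CrossFitting

variable {W Γ Ω : Type*} {K : ℕ}

/-- The cross-fitted first-step estimate `γ̂_k` for sample size `n`: `fold n i` is the group to
which the index `i` belongs, and the estimator `est n k` is applied to the observations whose
indices are not in the group `k`. -/
def crossFit (fold : (n : ℕ) → Fin n → Fin K)
    (est : (n : ℕ) → (k : Fin K) → ({i : Fin n // fold n i ≠ k} → W) → Γ)
    (w : ℕ → Ω → W) (n : ℕ) (k : Fin K) (ω : Ω) : Γ :=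
  est n k fun i => w (i : Fin n) ω

/-- The cross-fitted sample mean `(1/n) ∑_k ∑_{i ∈ I_k} f(w_i, γ̂_k)`. -/
def crossFitMean (fold : (n : ℕ) → Fin n → Fin K)
    (est : (n : ℕ) → (k : Fin K) → ({i : Fin n // fold n i ≠ k} → W) → Γ)
    (w : ℕ → Ω → W) (f : W → Γ → ℝ) (n : ℕ) (ω : Ω) : ℝ :=
  (1 / (n : ℝ)) * ∑ k : Fin K, ∑ i : Fin n with fold n i = k,
    f (w i ω) (crossFit fold est w n k ω)

end CrossFitting

section Assumptions

variable {W V Ω : Type*} [MeasurableSpace W] [MeasurableSpace Ω] {K : ℕ}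

/-- (i) Mean-square continuity: `∫ |ψ(w, β₀, γ̂_k) - ψ(w, β₀, γ₀)|² F₀(dw) → 0` in probability,
for each `k`.  The inner integral takes the value `∞` when the function is not
square-integrable. -/
def MeanSquareContinuity (P : Measure Ω) (F₀ : Measure W) (ψ : W → ℝ → Nuisance V → ℝ) (β₀ : ℝ)
    (γ₀ : Nuisance V) (γhat : ℕ → Fin K → Ω → Nuisance V) : Prop :=
  ∀ k, ∀ ε : ℝ≥0∞, 0 < ε → Tendsto (fun n => P {ω | ε ≤
    ∫⁻ w, ENNReal.ofReal ((ψ w β₀ (γhat n k ω) - ψ w β₀ γ₀) ^ 2) ∂F₀}) atTop (𝓝 0)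

/-- (ii) Quadratic bias: `|∫ ψ(w, β₀, γ̂_k) F₀(dw)| ≤ C ‖γ̂_k - γ₀‖²` for some `C > 0`,
for each `k`. -/
def QuadraticBias (P : Measure Ω) (F₀ : Measure W) (ψ : W → ℝ → Nuisance V → ℝ) (β₀ : ℝ)
    {S : Submodule ℝ (Nuisance V)} (N : Seminorm ℝ S) (γ₀ : S) (γhat : ℕ → Fin K → Ω → S) :
    Prop :=
  ∃ C : ℝ, 0 < C ∧ ∀ k, ∀ᶠ n in atTop, ∀ᵐ ω ∂P,
    |∫ w, ψ w β₀ (γhat n k ω) ∂F₀| ≤ C * N (γhat n k ω - γ₀) ^ 2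

/-- (iii) First-step rate: `‖γ̂_k - γ₀‖ = o_p(n^{-1/4})`, for each `k`. -/
def FirstStepRate (P : Measure Ω) {S : Submodule ℝ (Nuisance V)} (N : Seminorm ℝ S) (γ₀ : S)
    (γhat : ℕ → Fin K → Ω → S) : Prop :=
  ∀ k, TendstoInMeasure P
    (fun (n : ℕ) ω => N (γhat n k ω - γ₀) / (n : ℝ) ^ (-(1 / 4) : ℝ)) atTop (fun _ => 0)

/-- (iv) Hölder-type condition: there are `ζ > 0` and `d` with `E[d(W)²] < ∞` such that
`|ψ(w, β, γ) - ψ(w, β₀, γ₀)| ≤ d(w) (|β - β₀|^ζ + ‖γ - γ₀‖^ζ)` as soon as `|β - β₀|` and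
`‖γ - γ₀‖` are small enough. -/
def HolderCondition (F₀ : Measure W) (ψ : W → ℝ → Nuisance V → ℝ) (β₀ : ℝ)
    {S : Submodule ℝ (Nuisance V)} (N : Seminorm ℝ S) (γ₀ : S) : Prop :=
  ∃ ζ : ℝ, 0 < ζ ∧ ∃ d : W → ℝ, MemLp d 2 F₀ ∧ ∃ r : ℝ, 0 < r ∧
    ∀ᵐ w ∂F₀, ∀ (β : ℝ) (γ : S), |β - β₀| ≤ r → N (γ - γ₀) ≤ r →
      |ψ w β γ - ψ w β₀ γ₀| ≤ d w * (|β - β₀| ^ ζ + N (γ - γ₀) ^ ζ)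

end Assumptions

end

/-! Since `β` enters `ψ` only through the summand `-β`, the estimating equation is exactly linear:
`β̂ - β₀` equals the cross-fitted mean of `ψ(·, β₀, γ̂_k)`, and no expansion in `β` is needed
(`orthMoment_eq_sub`). With `γ₀` in place of `γ̂_k` this is an i.i.d. mean of a square-integrable
function, centred by the moment restriction and because an influence function integrates to zero;
the central limit theorem gives `N(0, Ω)`.

The cost of this replacement, times `√n`, splits within each group into a centred sum and a drift.
Given the observations outside the group, `γ̂_k` is fixed while those inside remain i.i.d. from
`F₀`; Chebyshev's inequality then bounds the centred sum through the mean-square distance in (i)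
(`tendstoInMeasure_crossFit_centered`). By (ii) the drift is at most `√n C ‖γ̂_k - γ₀‖² = C (‖γ̂_k -
γ₀‖ / n^{-1/4})²`, negligible by (iii). Slutsky's theorem concludes
(`tendstoInDistribution_crossFitMean`).

For the variance, (iv) bounds the change of `ψ²` by `(E + E²)(ψ₀² + d²)`, where `E` collects the
`ζ`-th powers of the estimation errors. Sample means of `ψ₀² + d²` converge to a finite limit and `E
→ 0`, so the law of large numbers for `ψ₀²` suffices. -/

/-! ### Convergence in measure to constants. -/

section ConvergenceInMeasure

variable {Ω E E' : Type*} [MeasurableSpace Ω] {P : Measure Ω}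

/-- If `Y n → c` in measure and `|X n - x| ≤ f (Y n)` as long as `Y n` is close to `c`, where `f`
tends to zero at `c`, then `X n → x` in measure. -/
theorem tendstoInMeasure_of_abs_sub_le [PseudoMetricSpace E] {Y : ℕ → Ω → E} {c : E}
    (hY : TendstoInMeasure P Y atTop fun _ => c) {X : ℕ → Ω → ℝ} {x : ℝ} {f : E → ℝ}
    (hf : Tendsto f (𝓝 c) (𝓝 0)) {U : Set E} (hU : U ∈ 𝓝 c)
    (h : ∀ᶠ n in atTop, ∀ᵐ ω ∂P, Y n ω ∈ U → |X n ω - x| ≤ f (Y n ω)) :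
    TendstoInMeasure P X atTop fun _ => x := by
  rw [tendstoInMeasure_iff_dist] at hY ⊢
  intro ε hε
  obtain ⟨η, hη, hball⟩ := Metric.mem_nhds_iff.1
    (inter_mem hU (hf.eventually (Iio_mem_nhds hε)))
  refine tendsto_of_tendsto_of_tendsto_of_le_of_le' tendsto_const_nhds (hY η hη)
    (Eventually.of_forall fun _ => zero_le) ?_
  filter_upwards [h] with n hn
  refine measure_mono_ae ?_
  filter_upwards [hn] with ω hω hX
  by_contra hlt
  obtain ⟨h1, h2⟩ := hball (show Y n ω ∈ Metric.ball c η from not_le.1 hlt)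
  exact absurd (hX.trans (hω h1)) (not_le.2 h2)

theorem MeasureTheory.TendstoInMeasure.prodMk_const [PseudoMetricSpace E] [PseudoMetricSpace E']
    {Y : ℕ → Ω → E} {Y' : ℕ → Ω → E'} {c : E} {c' : E'}
    (hY : TendstoInMeasure P Y atTop fun _ => c) (hY' : TendstoInMeasure P Y' atTop fun _ => c') :
    TendstoInMeasure P (fun n ω => (Y n ω, Y' n ω)) atTop fun _ => (c, c') := by
  rw [tendstoInMeasure_iff_dist] at *
  intro ε hε
  have h := (hY ε hε).add (hY' ε hε)
  rw [add_zero] at h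
  refine tendsto_of_tendsto_of_tendsto_of_le_of_le tendsto_const_nhds h (fun _ => zero_le) ?_
  intro n
  refine le_trans (measure_mono ?_) (measure_union_le _ _)
  intro ω hω
  simpa [Prod.dist_eq] using hω

theorem tendstoInMeasure_pi_const {ι : Type*} [Fintype ι] [PseudoMetricSpace E]
    {Y : ι → ℕ → Ω → E} {c : ι → E} (hY : ∀ k, TendstoInMeasure P (Y k) atTop fun _ => c k) :
    TendstoInMeasure P (fun n ω k => Y k n ω) atTop fun _ => c := by
  simp only [tendstoInMeasure_iff_dist] at *
  intro ε hε
  have h := tendsto_finsetSum Finset.univ fun k _ => hY k ε hε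
  rw [Finset.sum_const_zero] at h
  refine tendsto_of_tendsto_of_tendsto_of_le_of_le tendsto_const_nhds h (fun _ => zero_le) ?_
  intro n
  refine le_trans (measure_mono ?_) (measure_biUnion_finset_le _ _)
  intro ω hω
  by_contra hcon
  simp only [Set.mem_iUnion, not_exists, Set.mem_ofPred_eq, not_le, Finset.mem_univ,
    true_implies] at hcon hω
  exact absurd ((dist_pi_lt_iff hε).2 hcon) (not_lt.2 hω)

end ConvergenceInMeasure

/-! ### Chebyshev's inequality, conditional on an independent element. -/

section Chebyshev

variable {Ω W 𝒰 ι : Type*} [MeasurableSpace Ω] [MeasurableSpace W] [MeasurableSpace 𝒰] [Fintype ι]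
  {P : Measure Ω} [IsProbabilityMeasure P] {F : Measure W} {v : ι → Ω → W}

/-- Chebyshev's inequality for a centred sum of functions of i.i.d. random elements. -/
theorem measure_le_abs_sum_sub_integral_le (hv : ∀ i, Measurable (v i)) (hlaw : ∀ i, P.map (v i) = F)
    (hindep : iIndepFun v P) {f : W → ℝ} (hf : Measurable f) {η ε : ℝ} (hε : 0 < ε)
    (hη : ∫⁻ x, ENNReal.ofReal (f x ^ 2) ∂F < ENNReal.ofReal η) :
    P {ω | ε ≤ |∑ i, (f (v i ω) - ∫ x, f x ∂F)|}
      ≤ ENNReal.ofReal (Fintype.card ι * η / ε ^ 2) := by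
  have hsq : Integrable (fun x => f x ^ 2) F :=
    ⟨(hf.pow_const 2).aestronglyMeasurable, by
      rw [hasFiniteIntegral_iff_ofReal (ae_of_all _ fun x => sq_nonneg _)]
      exact hη.trans ENNReal.ofReal_lt_top⟩
  have hη' : ∫ x, f x ^ 2 ∂F ≤ η := by
    rw [integral_eq_lintegral_of_nonneg_ae (ae_of_all _ fun x => sq_nonneg _) hsq.1]
    have hpos : 0 < η := ENNReal.ofReal_pos.1 (zero_le.trans_lt hη)
    exact ENNReal.toReal_le_of_le_ofReal hpos.le hη.le
  have hf2 : MemLp f 2 F := (memLp_two_iff_integrable_sq hf.aestronglyMeasurable).2 hsq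
  have hX2 : ∀ i, MemLp (fun ω => f (v i ω)) 2 P := fun i => by
    have := hlaw i ▸ hf2
    exact this.comp_of_map (hv i).aemeasurable
  have hmean : ∀ i, ∫ ω, f (v i ω) ∂P = ∫ x, f x ∂F := fun i => by
    rw [← hlaw i, integral_map (hv i).aemeasurable hf.aestronglyMeasurable]
  have hvar : ∀ i, Var[fun ω => f (v i ω); P] ≤ η := fun i => by
    refine (variance_le_expectation_sq (hX2 i).1).trans (le_trans (le_of_eq ?_) hη')
    rw [← hlaw i, integral_map (hv i).aemeasurable (hf.pow_const 2).aestronglyMeasurable]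
    rfl
  have hsum : Var[∑ i, fun ω => f (v i ω); P] ≤ Fintype.card ι * η := by
    rw [IndepFun.variance_sum (fun i _ => hX2 i)
      (fun i _ j _ hij => (hindep.indepFun hij).comp hf hf)]
    refine (Finset.sum_le_sum fun i _ => hvar i).trans (le_of_eq ?_)
    simp
  have hS2 : MemLp (∑ i, fun ω => f (v i ω)) 2 P := memLp_finsetSum' _ fun i _ => hX2 i
  refine le_trans (le_of_eq ?_) ((meas_ge_le_variance_div_sq hS2 hε).trans
    (ENNReal.ofReal_le_ofReal (by gcongr)))
  congr 1
  ext ω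
  simp only [Finset.sum_apply, Finset.sum_sub_distrib]
  rw [integral_finsetSum _ fun i _ => (hX2 i).integrable (by norm_num)]
  simp only [hmean]

/-- Chebyshev's inequality, conditionally on an independent random element `u` on which the
summands may depend. -/
theorem measure_le_abs_sum_sub_integral_le_of_indepFun [SFinite F] {u : Ω → 𝒰} (hu : Measurable u)
    (hv : ∀ i, Measurable (v i)) (hlaw : ∀ i, P.map (v i) = F) (hindep : iIndepFun v P)
    (huv : IndepFun u (fun ω i => v i ω) P) {h : 𝒰 × W → ℝ} (hh : Measurable h)
    {η ε : ℝ} (hε : 0 < ε) :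
    P {ω | ε ≤ |∑ i, (h (u ω, v i ω) - ∫ x, h (u ω, x) ∂F)|}
      ≤ P {ω | ENNReal.ofReal η ≤ ∫⁻ x, ENNReal.ofReal (h (u ω, x) ^ 2) ∂F}
        + ENNReal.ofReal (Fintype.card ι * η / ε ^ 2) := by
  have hV : Measurable fun ω i => v i ω := measurable_pi_iff.2 hv
  have hA : Measurable fun y => ∫⁻ x, ENNReal.ofReal (h (y, x) ^ 2) ∂F :=
    Measurable.lintegral_prod_right' (f := fun q => ENNReal.ofReal (h q ^ 2))
      (hh.pow_const 2).ennreal_ofReal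
  have hint : Measurable fun y => ∫ x, h (y, x) ∂F :=
    (hh.stronglyMeasurable.integral_prod_right' (ν := F)).measurable
  have hS : Measurable fun q : 𝒰 × (ι → W) => |∑ i, (h (q.1, q.2 i) - ∫ x, h (q.1, x) ∂F)| := by
    refine Measurable.abs (Finset.measurable_fun_sum _ fun i _ => ?_)
    refine (hh.comp (measurable_fst.prodMk ?_)).sub (hint.comp measurable_fst)
    exact (measurable_pi_apply i).comp measurable_snd
  have hset : MeasurableSet {q : 𝒰 × (ι → W) | ε ≤ |∑ i, (h (q.1, q.2 i) - ∫ x, h (q.1, x) ∂F)|} :=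
    measurableSet_le measurable_const hS
  have hbad : MeasurableSet {y | ENNReal.ofReal η ≤ ∫⁻ x, ENNReal.ofReal (h (y, x) ^ 2) ∂F} :=
    measurableSet_le measurable_const hA
  have := Measure.isProbabilityMeasure_map (μ := P) hu.aemeasurable
  have := Measure.isProbabilityMeasure_map (μ := P) hV.aemeasurable
  calc P {ω | ε ≤ |∑ i, (h (u ω, v i ω) - ∫ x, h (u ω, x) ∂F)|}
      = (P.map fun ω => (u ω, fun i => v i ω))
          {q | ε ≤ |∑ i, (h (q.1, q.2 i) - ∫ x, h (q.1, x) ∂F)|} := by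
        rw [Measure.map_apply (hu.prodMk hV) hset]; rfl
    -- By independence the joint law is a product, so `u` can be frozen at `y` and integrated out
    -- last.
    _ = ∫⁻ y, P {ω | ε ≤ |∑ i, (h (y, v i ω) - ∫ x, h (y, x) ∂F)|} ∂(P.map u) := by
        rw [(indepFun_iff_map_prod_eq_prod_map_map hu.aemeasurable hV.aemeasurable).1 huv,
          Measure.prod_apply hset]
        refine lintegral_congr fun y => ?_
        rw [Measure.map_apply hV (measurable_prodMk_left hset)]
        rfl
    _ ≤ ∫⁻ y, ({y | ENNReal.ofReal η ≤ ∫⁻ x, ENNReal.ofReal (h (y, x) ^ 2) ∂F}.indicator 1 y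
          + ENNReal.ofReal (Fintype.card ι * η / ε ^ 2)) ∂(P.map u) := by
        refine lintegral_mono fun y => ?_
        -- Where the second moment of `h (y, ·)` is large, the probability is bounded by 1;
        -- elsewhere the unconditional inequality applies.
        by_cases hy : ENNReal.ofReal η ≤ ∫⁻ x, ENNReal.ofReal (h (y, x) ^ 2) ∂F
        · rw [Set.indicator_of_mem (by exact hy)]
          exact prob_le_one.trans le_self_add
        · refine le_trans ?_ le_add_self
          exact measure_le_abs_sum_sub_integral_le hv hlaw hindep
            (hh.comp measurable_prodMk_left) hε (not_le.1 hy)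
    _ = _ := by
        rw [lintegral_add_right _ measurable_const, lintegral_indicator_one hbad,
          Measure.map_apply hu hbad]
        simp

end Chebyshev

/-! ### Group-wise remainders, law of large numbers, central limit theorem. -/

section CrossFitLimits

variable {Ω W Γ : Type*} [MeasurableSpace Ω] [MeasurableSpace W] {P : Measure Ω}

/-- Complementary subfamilies of a finite independent family are independent. -/
theorem ProbabilityTheory.iIndepFun.indepFun_subtype_compl {ι : Type*} [Fintype ι] {v : ι → Ω → W}
    (hv : ∀ i, Measurable (v i)) (hindep : iIndepFun v P) (p : ι → Prop) [DecidablePred p] :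
    IndepFun (fun ω (i : {i // ¬ p i}) => v i ω) (fun ω (i : {i // p i}) => v i ω) P := by
  have h := hindep.indepFun_finset (Finset.univ.filter fun i => ¬ p i) (Finset.univ.filter p)
    (Finset.disjoint_filter_filter_not _ _ p).symm hv
  exact h.comp
    (φ := fun q (i : {i // ¬ p i}) => q ⟨i, by simpa using i.2⟩)
    (ψ := fun q (i : {i // p i}) => q ⟨i, by simpa using i.2⟩)
    (measurable_pi_iff.2 fun _ => measurable_pi_apply _)
    (measurable_pi_iff.2 fun _ => measurable_pi_apply _)

variable {K : ℕ} {fold : (n : ℕ) → Fin n → Fin K}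
  {est : (n : ℕ) → (k : Fin K) → ({i : Fin n // fold n i ≠ k} → W) → Γ} {w : ℕ → Ω → W}

/-- The centred and scaled sum over one group of the effect of estimating the first step is
asymptotically negligible if this effect tends to zero in mean square. -/
theorem tendstoInMeasure_crossFit_centered [IsProbabilityMeasure P] {F : Measure W} [SFinite F]
    (hw : ∀ i, Measurable (w i)) (hlaw : ∀ i, P.map (w i) = F) (hindep : iIndepFun w P)
    {g : W → Γ → ℝ} {g₀ : W → ℝ} (hg₀ : Measurable g₀) (k : Fin K)
    (hest : ∀ n, Measurable fun q : ({i : Fin n // fold n i ≠ k} → W) × W => g q.2 (est n k q.1))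
    (hms : ∀ ε : ℝ≥0∞, 0 < ε → Tendsto (fun n => P {ω | ε ≤
      ∫⁻ x, ENNReal.ofReal ((g x (crossFit fold est w n k ω) - g₀ x) ^ 2) ∂F}) atTop (𝓝 0)) :
    TendstoInMeasure P (fun (n : ℕ) ω => (√(n : ℝ))⁻¹ * ∑ i : Fin n with fold n i = k,
      (g (w i ω) (crossFit fold est w n k ω) - g₀ (w i ω)
        - ∫ x, (g x (crossFit fold est w n k ω) - g₀ x) ∂F)) atTop fun _ => 0 := by
  rw [tendstoInMeasure_iff_norm]
  intro ε hε
  rw [ENNReal.tendsto_nhds_zero]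
  intro t ht
  -- `t` may be infinite, hence a finite `s < t / 2`. With `η = s ε²` and threshold `√n ε`, the
  -- Chebyshev bound is at most `s`, because a group has at most `n` elements.
  obtain ⟨s, hs0, hst⟩ := exists_between (show 0 < t / 2 from ENNReal.half_pos ht.ne')
  have hs : s ≠ ∞ := (hst.trans_le le_top).ne
  have hspos : 0 < s.toReal := ENNReal.toReal_pos hs0.ne' hs
  have hη : 0 < s.toReal * ε ^ 2 := by positivity
  filter_upwards [ENNReal.tendsto_nhds_zero.1 (hms _ (ENNReal.ofReal_pos.2 hη)) (t / 2)
    (ENNReal.half_pos ht.ne'), eventually_gt_atTop 0] with n hn hn0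
  have hn' : (0 : ℝ) < n := Nat.cast_pos.2 hn0
  have hvn : iIndepFun (fun i : Fin n => w i) P := hindep.precomp Fin.val_injective
  -- Here `u` is the data outside group `k`, which determines the estimate, and `v` the data inside.
  have hcheb := measure_le_abs_sum_sub_integral_le_of_indepFun (P := P) (F := F)
    (u := fun ω (i : {i : Fin n // fold n i ≠ k}) => w i ω)
    (v := fun (i : {i : Fin n // fold n i = k}) => w i)
    (measurable_pi_iff.2 fun i => hw _) (fun i => hw _) (fun i => hlaw _)
    (hvn.precomp Subtype.val_injective)
    (hvn.indepFun_subtype_compl (fun i => hw _) fun i => fold n i = k)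
    (h := fun q => g q.2 (est n k q.1) - g₀ q.2) ((hest n).sub (hg₀.comp measurable_snd))
    (η := s.toReal * ε ^ 2) (ε := √(n : ℝ) * ε) (by positivity)
  have hcard : ENNReal.ofReal (Fintype.card {i : Fin n // fold n i = k} * (s.toReal * ε ^ 2)
      / (√(n : ℝ) * ε) ^ 2) ≤ t / 2 := by
    refine le_trans ?_ hst.le
    conv_rhs => rw [← ENNReal.ofReal_toReal hs]
    refine ENNReal.ofReal_le_ofReal ?_
    rw [mul_pow, Real.sq_sqrt hn'.le, div_le_iff₀ (by positivity)]
    have : (Fintype.card {i : Fin n // fold n i = k} : ℝ) ≤ n := by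
      exact_mod_cast (Fintype.card_subtype_le _).trans (Fintype.card_fin n).le
    nlinarith
  refine le_trans (le_trans (measure_mono fun ω hω => ?_) hcheb)
    ((add_le_add hn hcard).trans (ENNReal.add_halves t).le)
  have hω' : ε ≤ ‖(√(n : ℝ))⁻¹ * ∑ i : Fin n with fold n i = k,
      (g (w i ω) (crossFit fold est w n k ω) - g₀ (w i ω)
        - ∫ x, (g x (crossFit fold est w n k ω) - g₀ x) ∂F) - 0‖ := hω
  rw [sub_zero, norm_mul, norm_inv, Real.norm_eq_abs, abs_of_nonneg (Real.sqrt_nonneg _),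
    le_inv_mul_iff₀ (Real.sqrt_pos.2 hn'), Real.norm_eq_abs,
    Finset.sum_subtype (p := fun i => fold n i = k) _ (by simp)] at hω'
  exact hω'

/-- Weak law of large numbers for functions of i.i.d. observations. -/
theorem tendstoInMeasure_sample_mean [IsProbabilityMeasure P] {F : Measure W}
    (hw : ∀ i, Measurable (w i)) (hlaw : ∀ i, P.map (w i) = F) (hindep : iIndepFun w P)
    {f : W → ℝ} (hf : Integrable f F) :
    TendstoInMeasure P (fun (n : ℕ) ω => (1 / (n : ℝ)) * ∑ i : Fin n, f (w i ω)) atTop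
      fun _ => ∫ x, f x ∂F := by
  have hae : AEMeasurable f F := hf.1.aemeasurable
  have hcomp : ∀ i, AEMeasurable (fun ω => f (w i ω)) P := fun i =>
    (hlaw i ▸ hae).comp_measurable (hw i)
  have hid : ∀ i, IdentDistrib (w i) (w 0) P P := fun i =>
    ⟨(hw i).aemeasurable, (hw 0).aemeasurable, by rw [hlaw, hlaw]⟩
  have hlln := strong_law_ae_real (μ := P) (fun i ω => f (w i ω))
    ((hlaw 0 ▸ hf : Integrable f (P.map (w 0))).comp_measurable (hw 0))
    (fun i j hij => (hindep.indepFun hij).comp₀ (hw i).aemeasurable (hw j).aemeasurable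
      (hlaw i ▸ hae) (hlaw j ▸ hae))
    (fun i => (hid i).comp_of_aemeasurable (hlaw i ▸ hae))
  refine tendstoInMeasure_of_tendsto_ae (fun n => ?_) ?_
  · exact ((Finset.aemeasurable_fun_sum _ fun i _ => hcomp _).const_mul _).aestronglyMeasurable
  · filter_upwards [hlln] with ω hω
    have hmean : ∫ ω, f (w 0 ω) ∂P = ∫ x, f x ∂F := by
      rw [← integral_map (hw 0).aemeasurable (hlaw 0 ▸ hf.1), hlaw 0]
    rw [hmean] at hω
    refine hω.congr fun n => ?_
    rw [Finset.sum_range, one_div, inv_mul_eq_div]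

/-- Central limit theorem for centred functions of i.i.d. observations. -/
theorem tendstoInDistribution_sample_sum [IsProbabilityMeasure P] {F : Measure W}
    (hw : ∀ i, Measurable (w i)) (hlaw : ∀ i, P.map (w i) = F) (hindep : iIndepFun w P)
    {f : W → ℝ} (hfm : Measurable f) (hf : MemLp f 2 F) (hf0 : ∫ x, f x ∂F = 0) :
    TendstoInDistribution (fun (n : ℕ) ω => (√(n : ℝ))⁻¹ * ∑ i : Fin n, f (w i ω)) atTop id
      (fun _ => P) (gaussianReal 0 (∫ x, f x ^ 2 ∂F).toNNReal) := by
  have hmean : ∫ ω, f (w 0 ω) ∂P = 0 := by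
    rw [← integral_map (hw 0).aemeasurable hfm.aestronglyMeasurable, hlaw 0, hf0]
  have hvar : Var[fun ω => f (w 0 ω); P] = ∫ x, f x ^ 2 ∂F := by
    rw [variance_of_integral_eq_zero (X := fun ω => f (w 0 ω))
      (hfm.comp (hw 0)).aemeasurable hmean, ← hlaw 0, integral_map (hw 0).aemeasurable (hfm.pow_const 2).aestronglyMeasurable]
  have hclt := tendstoInDistribution_inv_sqrt_mul_sum_sub (P := P) (X := fun i ω => f (w i ω))
    (Y := id) (P' := gaussianReal 0 (∫ x, f x ^ 2 ∂F).toNNReal)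
    ⟨aemeasurable_id, by rw [hvar, Measure.map_id]⟩
    ((hlaw 0 ▸ hf : MemLp f 2 (P.map (w 0))).comp_of_map (hw 0).aemeasurable)
    (hindep.comp (fun _ => f) fun _ => hfm)
    (fun i => IdentDistrib.comp
      ⟨(hw i).aemeasurable, (hw 0).aemeasurable, by rw [hlaw, hlaw]⟩ hfm)
  simpa only [hmean, mul_zero, sub_zero, Finset.sum_range] using hclt

end CrossFitLimits

/-! ### Asymptotics of cross-fitted means. -/

section CrossFitEstimation

variable {Ω W Γ : Type*} {K : ℕ}
  {fold : (n : ℕ) → Fin n → Fin K}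
  {est : (n : ℕ) → (k : Fin K) → ({i : Fin n // fold n i ≠ k} → W) → Γ} {w : ℕ → Ω → W}

/-- The groups partition the sample, so a summand that ignores the first step has its ordinary
sample mean as cross-fitted mean. Applied with `f₀` the true moment, its square, or a constant. -/
theorem crossFitMean_eq_add (f : W → Γ → ℝ) (f₀ : W → ℝ) (n : ℕ) (ω : Ω) :
    crossFitMean fold est w f n ω = crossFitMean fold est w (fun x γ => f x γ - f₀ x) n ω
      + (1 / (n : ℝ)) * ∑ i : Fin n, f₀ (w i ω) := by
  have h : ∑ i : Fin n, f₀ (w i ω) = ∑ k : Fin K, ∑ i : Fin n with fold n i = k, f₀ (w i ω) :=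
    (Finset.sum_fiberwise _ _ _).symm
  simp only [crossFitMean, Finset.sum_sub_distrib, h]
  ring

theorem abs_crossFitMean_le {f : W → Γ → ℝ} {b : W → ℝ} {n : ℕ} {ω : Ω}
    (h : ∀ i : Fin n, |f (w i ω) (crossFit fold est w n (fold n i) ω)| ≤ b (w i ω)) :
    |crossFitMean fold est w f n ω| ≤ (1 / (n : ℝ)) * ∑ i : Fin n, b (w i ω) := by
  rw [crossFitMean, abs_mul, abs_of_nonneg (by positivity : (0 : ℝ) ≤ 1 / n),
    ← Finset.sum_fiberwise Finset.univ (fold n) fun i => b (w i ω)]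
  gcongr
  refine (Finset.abs_sum_le_sum_abs _ _).trans (Finset.sum_le_sum fun k _ => ?_)
  refine (Finset.abs_sum_le_sum_abs _ _).trans (Finset.sum_le_sum fun i hi => ?_)
  obtain rfl : fold n i = k := by simpa using hi
  exact h i

variable [MeasurableSpace Ω] [MeasurableSpace W] {P : Measure Ω}

theorem measurable_crossFitMean (hw : ∀ i, Measurable (w i)) {f : W → Γ → ℝ} (n : ℕ)
    (hest : ∀ k, Measurable fun q : ({i : Fin n // fold n i ≠ k} → W) × W => f q.2 (est n k q.1)) :
    Measurable (crossFitMean fold est w f n) := by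
  refine Measurable.const_mul (Finset.measurable_fun_sum _ fun k _ =>
    Finset.measurable_fun_sum _ fun i _ => ?_) _
  exact (hest k).comp ((measurable_pi_iff.2 fun _ => hw _).prodMk (hw _))

/-- Asymptotic normality of a cross-fitted sample mean whose summands are consistent in mean
square, with a bias that is quadratic in a first-step error of smaller order than `n^{-1/4}`. -/
theorem tendstoInDistribution_crossFitMean [IsProbabilityMeasure P] {F : Measure W} [SFinite F]
    (hw : ∀ i, Measurable (w i)) (hlaw : ∀ i, P.map (w i) = F) (hindep : iIndepFun w P)
    {g : W → Γ → ℝ} {g₀ : W → ℝ} (hg₀ : Measurable g₀) (hg₀i : Integrable g₀ F)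
    (hg₀2 : MemLp g₀ 2 F) (hmean : ∫ x, g₀ x ∂F = 0)
    (hest : ∀ n k, Measurable fun q : ({i : Fin n // fold n i ≠ k} → W) × W => g q.2 (est n k q.1))
    (hms : ∀ k, ∀ ε : ℝ≥0∞, 0 < ε → Tendsto (fun n => P {ω | ε ≤
      ∫⁻ x, ENNReal.ofReal ((g x (crossFit fold est w n k ω) - g₀ x) ^ 2) ∂F}) atTop (𝓝 0))
    {N : Γ → ℝ} {C : ℝ}
    (hbias : ∀ k, ∀ᶠ n in atTop, ∀ᵐ ω ∂P,
      |∫ x, g x (crossFit fold est w n k ω) ∂F| ≤ C * N (crossFit fold est w n k ω) ^ 2)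
    (hrate : ∀ k, TendstoInMeasure P
      (fun (n : ℕ) ω => N (crossFit fold est w n k ω) / (n : ℝ) ^ (-(1 / 4) : ℝ)) atTop
      fun _ => 0) :
    TendstoInDistribution (fun (n : ℕ) ω => √(n : ℝ) * crossFitMean fold est w g n ω) atTop id
      (fun _ => P) (gaussianReal 0 (∫ x, g₀ x ^ 2 ∂F).toNNReal) := by
  have hclt := tendstoInDistribution_sample_sum hw hlaw hindep hg₀ hg₀2 hmean
  have hsub : ∀ n k, Measurable
      fun q : ({i : Fin n // fold n i ≠ k} → W) × W => g q.2 (est n k q.1) - g₀ q.2 :=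
    fun n k => (hest n k).sub (hg₀.comp measurable_snd)
  have hrem : TendstoInMeasure P (fun (n : ℕ) ω =>
      √(n : ℝ) * crossFitMean fold est w (fun x γ => g x γ - g₀ x) n ω) atTop fun _ => 0 := by
    have hcen := tendstoInMeasure_pi_const (c := fun _ : Fin K => (0 : ℝ)) fun k =>
      tendstoInMeasure_crossFit_centered hw hlaw hindep hg₀ k (fun n => hest n k) (hms k)
    have hrates := tendstoInMeasure_pi_const (c := fun _ : Fin K => (0 : ℝ)) hrate
    -- The remainder is dominated by a continuous function, vanishing at 0, of the `K` centred sums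
    -- and the `K` scaled first-step errors.
    refine tendstoInMeasure_of_abs_sub_le (E := (Fin K → ℝ) × (Fin K → ℝ)) (hcen.prodMk_const hrates)
      (f := fun y => ∑ k, (|y.1 k| + C * y.2 k ^ 2)) ?_ univ_mem ?_
    · have : Continuous fun y : (Fin K → ℝ) × (Fin K → ℝ) => ∑ k, (|y.1 k| + C * y.2 k ^ 2) := by
        fun_prop
      have h := this.tendsto ((fun _ => 0), (fun _ => 0))
      have h0 : ∑ k : Fin K, (|(0 : ℝ)| + C * 0 ^ 2) = 0 := by simp
      rwa [h0] at h
    · filter_upwards [eventually_all.2 hbias, eventually_gt_atTop 0] with n hn hn0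
      filter_upwards [ae_all_iff.2 hn] with ω hω _
      have hn' : (0 : ℝ) < n := Nat.cast_pos.2 hn0
      have hs : √(n : ℝ) * (1 / n) = (√(n : ℝ))⁻¹ := by
        rw [one_div, ← div_eq_mul_inv, Real.sqrt_div_self', one_div]
      rw [sub_zero, crossFitMean, ← mul_assoc, hs, Finset.mul_sum]
      refine (Finset.abs_sum_le_sum_abs _ _).trans (Finset.sum_le_sum fun k _ => ?_)
      set γ := crossFit fold est w n k ω
      -- Integrability of `g · γ` is not needed: as `g₀` is integrable, either both integrals exist
      -- or both take the default value 0.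
      have hint : ∫ x, (g x γ - g₀ x) ∂F = ∫ x, g x γ ∂F := by
        by_cases hgi : Integrable (fun x => g x γ) F
        · rw [integral_sub hgi hg₀i, hmean, sub_zero]
        · rw [integral_undef hgi, integral_undef fun h => hgi ?_]
          exact (h.add hg₀i).congr (ae_of_all _ fun x => sub_add_cancel _ _)
      -- Centred sum plus drift; the drift is the group size times the bias.
      have hsplit : (√(n : ℝ))⁻¹ * ∑ i : Fin n with fold n i = k, (g (w i ω) γ - g₀ (w i ω))
          = (√(n : ℝ))⁻¹ * ∑ i : Fin n with fold n i = k,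
              (g (w i ω) γ - g₀ (w i ω) - ∫ x, (g x γ - g₀ x) ∂F)
            + (√(n : ℝ))⁻¹ * (((Finset.univ.filter fun i : Fin n => fold n i = k).card : ℝ)
              * ∫ x, g x γ ∂F) := by
        rw [Finset.sum_sub_distrib _ fun _ => ∫ x, (g x γ - g₀ x) ∂F, Finset.sum_const,
          nsmul_eq_mul, hint]
        ring
      rw [hsplit]
      refine (abs_add_le _ _).trans (add_le_add_right ?_ _)
      have hcard : ((Finset.univ.filter fun i : Fin n => fold n i = k).card : ℝ) ≤ n := by
        exact_mod_cast (Finset.card_le_univ _).trans (Fintype.card_fin n).le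
      have hquart : ((n : ℝ) ^ (-(1 / 4) : ℝ)) ^ 2 = (√(n : ℝ))⁻¹ := by
        rw [← Real.rpow_natCast, ← Real.rpow_mul hn'.le, Real.sqrt_eq_rpow, ← Real.rpow_neg hn'.le]
        norm_num
      rw [abs_mul, abs_mul, abs_of_nonneg (by positivity : (0 : ℝ) ≤ (√(n : ℝ))⁻¹), Nat.abs_cast,
        div_pow, hquart]
      calc _ ≤ (√(n : ℝ))⁻¹ * (n * (C * N γ ^ 2)) := by
            gcongr
            exact hω k
        _ = C * (N γ ^ 2 / (√(n : ℝ))⁻¹) := by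
            nth_rewrite 2 [← Real.mul_self_sqrt hn'.le]
            field_simp
  have hslut := hclt.add_of_tendstoInMeasure_const hrem fun n =>
    ((measurable_crossFitMean hw n (hsub n)).const_mul _).aemeasurable
  refine hslut.congr (fun n => ae_of_all _ fun ω => ?_) (ae_of_all _ fun x => add_zero _)
  -- Also valid for `n = 0`, where both sides are 0.
  have hs : √(n : ℝ) * (1 / n) = (√(n : ℝ))⁻¹ := by
    rw [one_div, ← div_eq_mul_inv, Real.sqrt_div_self', one_div]
  change (√(n : ℝ))⁻¹ * _ + √(n : ℝ) * _ = √(n : ℝ) * crossFitMean fold est w g n ω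
  rw [crossFitMean_eq_add g g₀, mul_add, ← mul_assoc, hs, add_comm]

/-- Consistency of the cross-fitted second moment under a Hölder condition. -/
theorem tendstoInMeasure_crossFitMean_sq [IsProbabilityMeasure P] {F : Measure W}
    (hw : ∀ i, Measurable (w i)) (hlaw : ∀ i, P.map (w i) = F) (hindep : iIndepFun w P)
    {ψ : W → ℝ → Γ → ℝ} {β₀ : ℝ} {g₀ d : W → ℝ} (hg₀ : MemLp g₀ 2 F) (hd : MemLp d 2 F)
    {N : Γ → ℝ} (hN : ∀ γ, 0 ≤ N γ) {ζ r : ℝ} (hζ : 0 < ζ) (hr : 0 < r)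
    (hH : ∀ᵐ x ∂F, ∀ (β : ℝ) (γ : Γ), |β - β₀| ≤ r → N γ ≤ r →
      |ψ x β γ - g₀ x| ≤ d x * (|β - β₀| ^ ζ + N γ ^ ζ))
    {βhat : ℕ → Ω → ℝ} (hβ : TendstoInMeasure P βhat atTop fun _ => β₀)
    (hNhat : ∀ k, TendstoInMeasure P (fun n ω => N (crossFit fold est w n k ω)) atTop
      fun _ => 0) :
    TendstoInMeasure P (fun n ω => crossFitMean fold est w (fun x γ => ψ x (βhat n ω) γ ^ 2) n ω)
      atTop fun _ => ∫ x, g₀ x ^ 2 ∂F := by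
  have hNs := tendstoInMeasure_pi_const (c := fun _ : Fin K => (0 : ℝ)) hNhat
  have hdi : Integrable (fun x => g₀ x ^ 2 + d x ^ 2) F := hg₀.integrable_sq.add hd.integrable_sq
  have hM := tendstoInMeasure_sample_mean hw hlaw hindep hdi
  have hG := tendstoInMeasure_sample_mean hw hlaw hindep hg₀.integrable_sq
  have hβN := hβ.prodMk_const hNs
  have hMG := hM.prodMk_const hG
  have hY := hβN.prodMk_const hMG
  -- The absolute values make `e` continuous on the whole space; they are harmless at the errors `N
  -- γ̂_k ≥ 0`. Summing over `k` gives one bound for all groups.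
  let e : ℝ × (Fin K → ℝ) → ℝ := fun y => |y.1 - β₀| ^ ζ + ∑ k, |y.2 k| ^ ζ
  have he : Continuous e := by
    have hpow : Continuous fun t : ℝ => |t| ^ ζ := continuous_abs.rpow_const fun _ => Or.inr hζ.le
    have h1 : Continuous fun y : ℝ × (Fin K → ℝ) => |y.1 - β₀| ^ ζ :=
      hpow.comp (g := fun t : ℝ => |t| ^ ζ) (continuous_fst.sub continuous_const)
    have h2 : ∀ k, Continuous fun y : ℝ × (Fin K → ℝ) => |y.2 k| ^ ζ := fun k =>
      hpow.comp (g := fun t : ℝ => |t| ^ ζ) ((continuous_apply k).comp continuous_snd)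
    exact h1.add (continuous_finsetSum _ fun k _ => h2 k)
  have hnear : ∀ m s : ℝ, {y : (ℝ × (Fin K → ℝ)) × ℝ × ℝ |
      y.1 ∈ Metric.closedBall (β₀, fun _ => (0 : ℝ)) r} ∈ 𝓝 ((β₀, fun _ => (0 : ℝ)), m, s) :=
    fun m s => (continuous_fst.tendsto ((β₀, fun _ => (0 : ℝ)), m, s)).eventually
      (Metric.closedBall_mem_nhds _ hr)
  refine tendstoInMeasure_of_abs_sub_le (E := (ℝ × (Fin K → ℝ)) × ℝ × ℝ) hY
    (f := fun y => (e y.1 + e y.1 ^ 2) * y.2.1 + |y.2.2 - ∫ x, g₀ x ^ 2 ∂F|)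
    ?_ (hnear _ _) ?_
  · have hcont : Continuous fun y : (ℝ × (Fin K → ℝ)) × ℝ × ℝ =>
        (e y.1 + e y.1 ^ 2) * y.2.1 + |y.2.2 - ∫ x, g₀ x ^ 2 ∂F| := by fun_prop
    have h0 : e (β₀, fun _ => 0) = 0 := by simp [e, Real.zero_rpow hζ.ne']
    have := hcont.tendsto
      ((β₀, fun _ => 0), ∫ x, (g₀ x ^ 2 + d x ^ 2) ∂F, ∫ x, g₀ x ^ 2 ∂F)
    simpa [h0] using this
  · refine Eventually.of_forall fun n => ?_
    have hHn : ∀ᵐ ω ∂P, ∀ i : Fin n, ∀ (β : ℝ) (γ : Γ), |β - β₀| ≤ r → N γ ≤ r →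
        |ψ (w i ω) β γ - g₀ (w i ω)| ≤ d (w i ω) * (|β - β₀| ^ ζ + N γ ^ ζ) :=
      ae_all_iff.2 fun i => ae_of_ae_map (hw i).aemeasurable ((hlaw i).symm ▸ hH)
    filter_upwards [hHn] with ω hω hU
    obtain ⟨hUβ, hUN⟩ : |βhat n ω - β₀| ≤ r ∧ ∀ k, N (crossFit fold est w n k ω) ≤ r := by
      have hU' := Prod.dist_eq.symm.le.trans (Metric.mem_closedBall.1 hU)
      refine ⟨(le_max_left _ _).trans hU', fun k => ?_⟩
      have := (dist_le_pi_dist _ _ k).trans ((le_max_right _ _).trans hU')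
      exact (le_abs_self _).trans (by simpa [Real.dist_eq] using this)
    set E := e (βhat n ω, fun k => N (crossFit fold est w n k ω))
    have hE0 : 0 ≤ E := by positivity
    have hEk : ∀ k, |βhat n ω - β₀| ^ ζ + N (crossFit fold est w n k ω) ^ ζ ≤ E := fun k => by
      refine add_le_add_right ?_ _
      have := Finset.single_le_sum (f := fun k => |N (crossFit fold est w n k ω)| ^ ζ)
        (fun j _ => by positivity) (Finset.mem_univ k)
      rwa [abs_of_nonneg (hN _)] at this
    have hmain : |crossFitMean fold est w (fun x γ => ψ x (βhat n ω) γ ^ 2 - g₀ x ^ 2) n ω|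
        ≤ (1 / (n : ℝ)) * ∑ i : Fin n, (E + E ^ 2) * (g₀ (w i ω) ^ 2 + d (w i ω) ^ 2) := by
      refine abs_crossFitMean_le (b := fun x => (E + E ^ 2) * (g₀ x ^ 2 + d x ^ 2)) fun i => ?_
      set a := ψ (w i ω) (βhat n ω) (crossFit fold est w n (fold n i) ω)
      set b := g₀ (w i ω)
      set D := d (w i ω)
      -- `d` may be negative, so it is replaced by `|D|` before the nonnegative Hölder factor is
      -- enlarged to `E`.
      have h1 : |a - b| ≤ |D| * E := by
        have h := hω i _ _ hUβ (hUN (fold n i))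
        have := hEk (fold n i)
        have h0 : 0 ≤ |βhat n ω - β₀| ^ ζ + N (crossFit fold est w n (fold n i) ω) ^ ζ :=
          add_nonneg (by positivity) (Real.rpow_nonneg (hN _) _)
        exact h.trans (mul_le_mul (le_abs_self _) this h0 (abs_nonneg _))
      have h2 : |a + b| ≤ |D| * E + 2 * |b| := by
        calc |a + b| = |(a - b) + 2 * b| := by ring_nf
          _ ≤ |a - b| + |2 * b| := abs_add_le _ _
          _ ≤ _ := by rw [abs_mul, abs_two]; gcongr
      calc |a ^ 2 - b ^ 2| = |a - b| * |a + b| := by rw [← abs_mul]; ring_nf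
        _ ≤ (|D| * E) * (|D| * E + 2 * |b|) := by gcongr
        _ = E ^ 2 * D ^ 2 + E * (2 * |b| * |D|) := by rw [← sq_abs D]; ring
        _ ≤ E ^ 2 * (b ^ 2 + D ^ 2) + E * (b ^ 2 + D ^ 2) := by
          have := two_mul_le_add_sq |b| |D|
          rw [sq_abs, sq_abs] at this
          gcongr
          nlinarith [sq_nonneg b]
        _ = _ := by ring
    rw [crossFitMean_eq_add _ fun x => g₀ x ^ 2, add_sub_assoc]
    refine (abs_add_le _ _).trans (add_le_add_left (hmain.trans (le_of_eq ?_)) _)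
    rw [← Finset.mul_sum]
    ring

end CrossFitEstimation

/-! ### Mean zero of influence functions, and linearity of the moment in `β`. -/

section Influence

theorem mixPath_self {W : Type*} [MeasurableSpace W] (F : Measure W) {τ : ℝ}
    (hτ : τ ∈ Set.Icc (0 : ℝ) 1) : mixPath F F τ = F := by
  rw [mixPath, ← add_smul, ← ENNReal.ofReal_add (sub_nonneg.2 hτ.2) hτ.1]
  simp

namespace IsFirstStepInfluence

variable {W Γ : Type*} [MeasurableSpace W] {F : Measure W} [IsProbabilityMeasure F]
  {γF : Measure W → Γ} {μ : W → Γ → ℝ} {φ₀ : W → ℝ}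

/-- The moment function is integrable at the true value of the first step. -/
theorem integrable_moment (h : IsFirstStepInfluence F γF μ φ₀) :
    Integrable (fun x => μ x (γF F)) F := by
  -- With `G = F` the path is constant, and what holds eventually in `𝓝[Icc 0 1] 0` holds at `τ = 0`
  -- itself.
  have h0 := (h.2 F inferInstance ⟨1, by simp⟩).1.self_of_nhdsWithin
    (Set.left_mem_Icc.2 zero_le_one)
  rwa [mixPath_self F (Set.left_mem_Icc.2 zero_le_one)] at h0

/-- An influence function has mean zero. -/
theorem integral_eq_zero (h : IsFirstStepInfluence F γF μ φ₀) : ∫ x, φ₀ x ∂F = 0 := by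
  have hd := (h.2 F inferInstance ⟨1, by simp⟩).2
  have hc : HasDerivWithinAt (fun τ : ℝ => ∫ x, μ x (γF (mixPath F F τ)) ∂F) 0
      (Set.Icc 0 1) 0 :=
    (hasDerivWithinAt_const (0 : ℝ) (Set.Icc 0 1) (∫ x, μ x (γF F) ∂F)).congr
      (fun τ hτ => by rw [mixPath_self F hτ])
      (by rw [mixPath_self F (Set.left_mem_Icc.2 zero_le_one)])
  -- The derivative is one-sided, but still unique, since `[0, 1]` is a set of unique
  -- differentiability at its endpoint 0.
  exact (uniqueDiffOn_Icc zero_lt_one 0 (Set.left_mem_Icc.2 zero_le_one)).eq_deriv _ hd hc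

end IsFirstStepInfluence

theorem orthMoment_eq_sub {𝒳 𝒵 : Type*} (side : BoundSide) (δ δs : 𝒳 → Bool)
    (ΔL ΔU : Nuisance (𝒳 × 𝒵) → 𝒳 → ℝ) (φ : Obs 𝒳 𝒵 → Nuisance (𝒳 × 𝒵) → ℝ)
    (w : Obs 𝒳 𝒵) (β β₀ : ℝ) (γ : Nuisance (𝒳 × 𝒵)) :
    orthMoment side δ δs ΔL ΔU φ w β γ
      = orthMoment side δ δs ΔL ΔU φ w β₀ γ - (β - β₀) := by
  cases side <;> simp only [orthMoment, boundMoment] <;> ring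

end Influence

/-! ### The bounds on the welfare gain. -/

theorem theorem4 {𝒳 𝒵 Ω : Type*} [MeasurableSpace 𝒳] [MeasurableSpace 𝒵] [MeasurableSpace Ω]
    (P : Measure Ω) [IsProbabilityMeasure P]
    (F₀ : Measure (Obs 𝒳 𝒵)) [IsProbabilityMeasure F₀]
    (hY : Integrable Obs.outcome F₀)
    -- the nuisance parameter as a function of the distribution of `W`
    (γF : Measure (Obs 𝒳 𝒵) → Nuisance (𝒳 × 𝒵))
    (hγF : ∀ F : Measure (Obs 𝒳 𝒵), IsProbabilityMeasure F → Integrable Obs.outcome F →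
      IsNuisanceOf F (γF F))
    -- the normed space of nuisance parameters, and the true value in it
    (S : Submodule ℝ (Nuisance (𝒳 × 𝒵))) (N : Seminorm ℝ S)
    (γ₀ : S) (hγ₀ : (γ₀ : Nuisance (𝒳 × 𝒵)) = γF F₀)
    -- the lower or upper bound, its moment restriction and the orthogonalized moment function
    (side : BoundSide) (δ δs : 𝒳 → Bool) (ΔL ΔU : Nuisance (𝒳 × 𝒵) → 𝒳 → ℝ)
    (β₀ : ℝ) (hβ₀ : ∫ w, boundMoment side δ δs ΔL ΔU w β₀ γ₀ ∂F₀ = 0)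
    (φ : Obs 𝒳 𝒵 → Nuisance (𝒳 × 𝒵) → ℝ)
    (hφ : IsFirstStepInfluence F₀ γF (fun w γ => boundMoment side δ δs ΔL ΔU w β₀ γ)
      (fun w => φ w γ₀))
    (ψ : Obs 𝒳 𝒵 → ℝ → Nuisance (𝒳 × 𝒵) → ℝ) (hψ : ψ = orthMoment side δ δs ΔL ΔU φ)
    -- i.i.d. data
    (w : ℕ → Ω → Obs 𝒳 𝒵) (hw : ∀ i, Measurable (w i)) (hlaw : ∀ i, P.map (w i) = F₀)
    (hindep : iIndepFun w P)
    -- cross-fitting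
    (K : ℕ) (hK : 1 < K) (fold : (n : ℕ) → Fin n → Fin K)
    (est : (n : ℕ) → (k : Fin K) → ({i : Fin n // fold n i ≠ k} → Obs 𝒳 𝒵) → S)
    (hest : ∀ n k, Measurable
      fun q : ({i : Fin n // fold n i ≠ k} → Obs 𝒳 𝒵) × Obs 𝒳 𝒵 => ψ q.2 β₀ (est n k q.1))
    -- the estimator solves the cross-fitted sample moment equation and is consistent
    (βhat : ℕ → Ω → ℝ)
    (hβhat : ∀ n, ∀ᵐ ω ∂P, crossFitMean fold est w (fun v γ => ψ v (βhat n ω) γ) n ω = 0)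
    (hcons : TendstoInMeasure P βhat atTop (fun _ => β₀))
    -- regularity conditions
    (hi : MeanSquareContinuity P F₀ ψ β₀ γ₀ (fun n k ω => (crossFit fold est w n k ω : S)))
    (hii : QuadraticBias P F₀ ψ β₀ N γ₀ (crossFit fold est w))
    (hiii : FirstStepRate P N γ₀ (crossFit fold est w))
    (hΩ : Integrable (fun v => ψ v β₀ γ₀ ^ 2) F₀) :
    TendstoInDistribution (fun (n : ℕ) ω => √(n : ℝ) * (βhat n ω - β₀)) atTop id (fun _ => P)
      (gaussianReal 0 (∫ v, ψ v β₀ γ₀ ^ 2 ∂F₀).toNNReal) ∧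
    (HolderCondition F₀ ψ β₀ N γ₀ →
      TendstoInMeasure P
        (fun n ω => crossFitMean fold est w (fun v γ => ψ v (βhat n ω) γ ^ 2) n ω) atTop
        (fun _ => ∫ v, ψ v β₀ γ₀ ^ 2 ∂F₀)) := by
  have hint : Integrable (fun v => ψ v β₀ γ₀) F₀ := by
    rw [hψ]
    have := hφ.integrable_moment.add hφ.1
    rw [← hγ₀] at this
    exact this
  have hmean : ∫ v, ψ v β₀ γ₀ ∂F₀ = 0 := by
    have h := hφ.integrable_moment
    rw [← hγ₀] at h
    rw [hψ]
    change ∫ v, (boundMoment side δ δs ΔL ΔU v β₀ γ₀ + φ v γ₀) ∂F₀ = 0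
    rw [integral_add h hφ.1, hβ₀, hφ.integral_eq_zero, add_zero]
  -- Integrability gives only a.e. measurability of the true moment, whereas the conditional
  -- Chebyshev argument needs a measurable function; hence a measurable version.
  set g₀ := hint.1.mk (fun v => ψ v β₀ γ₀)
  have hg₀ : Measurable g₀ := hint.1.stronglyMeasurable_mk.measurable
  have hae : (fun v => ψ v β₀ γ₀) =ᵐ[F₀] g₀ := hint.1.ae_eq_mk
  have hsq : ∫ v, ψ v β₀ γ₀ ^ 2 ∂F₀ = ∫ v, g₀ v ^ 2 ∂F₀ :=
    integral_congr_ae (hae.fun_comp (· ^ 2))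
  have hg₀2 : MemLp g₀ 2 F₀ := ((memLp_two_iff_integrable_sq hint.1).2 hΩ).ae_eq hae
  rw [hsq]
  constructor
  · obtain ⟨C, -, hC⟩ := hii
    have hlim := tendstoInDistribution_crossFitMean hw hlaw hindep (g := fun v (γ : S) => ψ v β₀ γ)
      hg₀ (hint.congr hae) hg₀2 ((integral_congr_ae hae).symm.trans hmean) hest
      (fun k ε hε => by
        refine (hi k ε hε).congr fun n => ?_
        congr 1
        ext ω
        rw [Set.mem_ofPred_eq, Set.mem_ofPred_eq, lintegral_congr_ae]
        filter_upwards [hae] with v hv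
        rw [← hv])
      (N := fun γ => N (γ - γ₀)) hC hiii
    refine hlim.congr (fun n => ?_) (ae_of_all _ fun _ => rfl)
    filter_upwards [hβhat n] with ω hω
    -- For `n = 0` the estimating equation is void, but the factor `√0` makes both sides vanish.
    rcases Nat.eq_zero_or_pos n with rfl | hn
    · simp
    have hn' : (n : ℝ) ≠ 0 := Nat.cast_ne_zero.2 hn.ne'
    -- For fixed `ω` the shift `-(β̂ - β₀)` is a constant, so the estimating equation reads: mean of
    -- `ψ(·, β₀, γ̂_k)` minus `β̂ - β₀` equals 0.
    rw [crossFitMean_eq_add _ fun _ => -(βhat n ω - β₀)] at hω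
    have hshift : (fun v (γ : S) => ψ v (βhat n ω) γ - -(βhat n ω - β₀))
        = fun v (γ : S) => ψ v β₀ γ := by
      funext v γ
      rw [hψ, orthMoment_eq_sub side δ δs ΔL ΔU φ v (βhat n ω) β₀]
      ring
    rw [hshift, Finset.sum_const, Finset.card_univ, Fintype.card_fin, nsmul_eq_mul,
      ← mul_assoc, one_div_mul_cancel hn', one_mul] at hω
    rw [show βhat n ω - β₀ = crossFitMean fold est w (fun v (γ : S) => ψ v β₀ γ) n ω by linarith]
  · rintro ⟨ζ, hζ, d, hd, r, hr, hH⟩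
    refine tendstoInMeasure_crossFitMean_sq hw hlaw hindep (ψ := fun v β (γ : S) => ψ v β γ)
      hg₀2 hd (N := fun γ => N (γ - γ₀)) (fun γ => apply_nonneg N _) hζ hr ?_ hcons fun k => ?_
    · filter_upwards [hH, hae] with v hv hv' β γ
      rw [← hv']
      exact hv β γ
    · refine tendstoInMeasure_of_abs_sub_le (hiii k) (f := fun t => |t|)
        (by simpa using (continuous_abs.tendsto (0 : ℝ))) univ_mem ?_
      filter_upwards [eventually_gt_atTop 0] with n hn
      refine ae_of_all _ fun ω _ => ?_
      have hn1 : (1 : ℝ) ≤ n := Nat.one_le_cast.2 hn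
      have hpos : (0 : ℝ) < (n : ℝ) ^ (-(1 / 4) : ℝ) := by positivity
      rw [sub_zero, abs_div, abs_of_pos hpos, le_div_iff₀ hpos]
      exact mul_le_of_le_one_right (abs_nonneg _)
        (Real.rpow_le_one_of_one_le_of_nonpos hn1 (by norm_num))
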